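/- Let $\mathsf h \neq \{0\}$ be a finite-dimensional complex Hilbert space and let $\mathcal T=(\mathcal T_t)_{t\ge 0}$ be a quantum Markov semigroup on $\mathcal B(\mathsf h)$, i.e. a weakly$^*$-continuous semigroup ($\mathcal T_0=\mathrm{id}$, $\mathcal T_{s+t}=\mathcal T_s\mathcal T_t$) of completely positive, identity preserving, normal linear maps on $\mathcal B(\mathsf h)$. A density is a positive operator $\rho$ on $\mathsf h$ with $\operatorname{tr}\rho=1$; it is faithful if the closure of its range is $\mathsf h$, and invariant if $\operatorname{tr}(\rho\,\mathcal T_t(x))=\operatorname{tr}(\rho x)$ for all $t\ge 0$ and $x\in\mathcal B(\mathsf h)$. A completely positive map $\Phi$ on $\mathcal B(\mathsf h)$ is irreducible if every orthogonal projection $p$ with $\Phi(p)\ge p$ is $0$ or $\mathbf 1$; the semigroup $\mathcal T$ is irreducible if every orthogonal projection $p$ with $\mathcal T_t(p)\ge p$ for all $t\ge0$ is $0$ or $\mathbf 1$; and $\mathcal T$ is primitive if it has a faithful invariant density which is its only invariant density. Then $\mathcal T$ admits an invariant density, and the following statements are equivalent: 1. $\mathcal T$ is irreducible; 2. $\mathcal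 T$ is primitive; 3. $\mathcal T_{t_0}$ is irreducible for all $t_0>0$; 4. $\mathcal T_{t_0}$ is irreducible for some $t_0>0$. -/

import Mathlib

open scoped NNReal CStarAlgebra Topology

noncomputable section

namespace QuantumMarkov

variable {h : Type*} [NormedAddCommGroup h] [InnerProductSpace ℂ h] [CompleteSpace h]

/-- Irreducibility of a completely positive map on `B(h)`: the only orthogonal projections `p`
with `Φ p ≥ p` (Loewner order) are `0` and the identity. -/
def IsIrreducibleMap (Φ : (h →L[ℂ] h) →CP (h →L[ℂ] h)) : Prop :=
  ∀ p : h →L[ℂ] h, IsStarProjection p → p ≤ Φ p → p = 0 ∨ p = 1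

variable [FiniteDimensional ℂ h]

/-- The trace of an operator on a finite-dimensional Hilbert space. -/
def tr (x : h →L[ℂ] h) : ℂ := LinearMap.trace ℂ h (x : h →ₗ[ℂ] h)

variable (h) in
/-- The weak-star topology on `B(h)`: the coarsest topology that makes `x ↦ tr (η x)` continuous
for all trace class `η`. For finite-dimensional `h` every operator `η` is trace class. -/
abbrev weakStarTopology : TopologicalSpace (h →L[ℂ] h) :=
  TopologicalSpace.induced (fun x η : h →L[ℂ] h => tr (η * x)) Pi.topologicalSpace

variable (h) in
/-- A quantum Markov semigroup on `B(h)`, for `h` finite-dimensional: a weakly-star continuous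
one-parameter semigroup of completely positive, identity preserving, normal maps. -/
structure QMS where
  /-- The completely positive map at time `t`. -/
  map : ℝ≥0 → ((h →L[ℂ] h) →CP (h →L[ℂ] h))
  map_zero : ∀ x, map 0 x = x
  map_add : ∀ s t x, map (s + t) x = map s (map t x)
  map_one : ∀ t, map t 1 = 1
  normal : ∀ t, Continuous[weakStarTopology h, weakStarTopology h] (map t)
  weakStar_continuous : ∀ x, 
    Continuous[NNReal.instTopologicalSpace, weakStarTopology h] fun t : ℝ≥0 => map t x

/-- A density: a positive operator of unit trace. -/
def IsDensity (ρ : h →L[ℂ] h) : Prop := 0 ≤ ρ ∧ tr ρ = 1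

/-- An operator is faithful if its support, the closure of its range, is the whole space. -/
def IsFaithful (ρ : h →L[ℂ] h) : Prop :=
  (LinearMap.range (ρ : h →ₗ[ℂ] h)).topologicalClosure = ⊤

namespace QMS

/-- Invariance of a density `ρ`: `tr (ρ T_t(x)) = tr (ρ x)` for all `t ≥ 0` and all `x`, that is,
the predual semigroup fixes `ρ`. -/
def IsInvariant (T : QMS h) (ρ : h →L[ℂ] h) : Prop :=
  ∀ (t : ℝ≥0) (x : h →L[ℂ] h), tr (ρ * T.map t x) = tr (ρ * x)

/-- Irreducibility of a semigroup: there is no non-trivial common subharmonic projection. -/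
def IsIrreducible (T : QMS h) : Prop :=
  ∀ p : h →L[ℂ] h, IsStarProjection p → (∀ t : ℝ≥0, p ≤ T.map t p) → p = 0 ∨ p = 1

/-- Primitivity: there is an invariant density that is faithful and is the only invariant
density. -/
def IsPrimitive (T : QMS h) : Prop :=
  ∃ ρ : h →L[ℂ] h, IsDensity ρ ∧ T.IsInvariant ρ ∧ IsFaithful ρ ∧
    ∀ σ : h →L[ℂ] h, IsDensity σ → T.IsInvariant σ → σ = ρ

end QMS

end QuantumMarkov

end

/-! A subharmonic projection `p ≠ 0` carries an invariant density: average a unit vector of its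
range over time and take a limit (`exists_invariant_density_of_subharmonic`). With `p = 1` this
gives existence; with general `p` it gives primitive ⇒ irreducible. Conversely, supports of
invariant positive operators are subharmonic, so under irreducibility such operators are zero or
invertible, and comparing two densities gives uniqueness.

The hard point is that irreducibility passes to each single map `T.map t₀`. A faithful invariant
density forces equality in Kadison–Schwarz on the fixed points of `T.map t₀`, so the whole semigroup
acts multiplicatively there. A common eigenvector `x` with eigenvalues `c t` satisfies the minimal
polynomial of `x` after scaling by `c t`; this leaves finitely many values, and continuity in `t`
gives `c = 1` (`map_eq_of_eigenvector`). Hence those fixed points are scalars. -/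

set_option linter.unusedSectionVars false

open scoped ComplexOrder InnerProductSpace

/-! ### Kadison–Schwarz inequality -/

namespace CompletelyPositiveMap

/-- The Kadison–Schwarz inequality for unital completely positive maps. -/
theorem star_map_mul_map_le {A B : Type*} [CStarAlgebra A] [CStarAlgebra B] [PartialOrder A]
    [PartialOrder B] [StarOrderedRing A] [StarOrderedRing B] (Φ : A →CP B) (hΦ : Φ 1 = 1) (x : A) :
    star (Φ x) * Φ x ≤ Φ (star x * x) := by
  -- `star R * R` has rows `(1, x)` and `(x*, x*x)`. Compressing its image to the column `(-Φ x, 1)`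
  -- leaves the Schwarz defect as the corner entry.
  let R : CStarMatrix (Fin 2) (Fin 2) A := CStarMatrix.ofMatrix !![1, x; 0, 0]
  let C : CStarMatrix (Fin 2) (Fin 2) B := CStarMatrix.ofMatrix !![-Φ x, 0; 1, 0]
  have hM := Φ.map_cstarMatrix_nonneg (star R * R) (star_mul_self_nonneg R)
  have hpos := star_left_conjugate_nonneg hM C
  have hentry : 0 ≤ (star C * (star R * R).map Φ * C) 0 0 := by
    rw [StarOrderedRing.nonneg_iff] at hpos
    generalize star C * (star R * R).map Φ * C = P at hpos ⊢
    induction hpos using AddSubmonoid.closure_induction with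
    | mem M hM =>
      obtain ⟨D, rfl⟩ := hM
      change 0 ≤ (star D * D) 0 0
      rw [CStarMatrix.mul_apply]
      exact Finset.sum_nonneg fun i _ => by
        rw [CStarMatrix.star_apply]
        exact star_mul_self_nonneg _
    | zero => exact le_rfl
    | add M N _ _ hM hN => exact add_nonneg hM hN
  have hstar : Φ (star x) = star (Φ x) := map_star Φ x
  have hcalc : (star C * (star R * R).map Φ * C) 0 0 = Φ (star x * x) - star (Φ x) * Φ x := by
    simp [CStarMatrix.mul_apply, CStarMatrix.star_apply, R, C, Fin.sum_univ_two, hΦ, hstar,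
      CStarMatrix.map_apply, sub_eq_neg_add]
  rw [hcalc] at hentry
  exact sub_nonneg.mp hentry

end CompletelyPositiveMap

/-! ### Trace pairing and positivity -/

namespace QuantumMarkov

variable {h : Type*} [NormedAddCommGroup h] [InnerProductSpace ℂ h] [CompleteSpace h]
  [FiniteDimensional ℂ h]

theorem tr_mul_comm (x y : h →L[ℂ] h) : tr (x * y) = tr (y * x) :=
  LinearMap.trace_mul_comm ℂ (x : h →ₗ[ℂ] h) y

theorem tr_add (x y : h →L[ℂ] h) : tr (x + y) = tr x + tr y := by simp [tr]

theorem tr_sub (x y : h →L[ℂ] h) : tr (x - y) = tr x - tr y := by simp [tr]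

theorem tr_smul (c : ℂ) (x : h →L[ℂ] h) : tr (c • x) = c * tr x := by simp [tr]

theorem tr_zero : tr (0 : h →L[ℂ] h) = 0 := by simp [tr]

theorem tr_mul_rankOne (x : h →L[ℂ] h) (u v : h) :
    tr (x * InnerProductSpace.rankOne ℂ u v) = ⟪v, x u⟫_ℂ := by
  have : x * InnerProductSpace.rankOne ℂ u v = InnerProductSpace.rankOne ℂ (x u) v := by
    ext w; simp
  rw [this]
  exact InnerProductSpace.trace_rankOne (x u) v

theorem tr_star_mul_self (x : h →L[ℂ] h) :
    tr (star x * x) = ((∑ i, ‖x (stdOrthonormalBasis ℂ h i)‖ ^ 2 : ℝ) : ℂ) := by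
  rw [tr, LinearMap.trace_eq_sum_inner _ (stdOrthonormalBasis ℂ h)]
  push_cast
  refine Finset.sum_congr rfl fun i _ => ?_
  simp [ContinuousLinearMap.star_eq_adjoint, ContinuousLinearMap.adjoint_inner_right,
    inner_self_eq_norm_sq_to_K]

theorem tr_star_mul_self_eq_zero {x : h →L[ℂ] h} (hx : tr (star x * x) = 0) : x = 0 := by
  rw [tr_star_mul_self, Complex.ofReal_eq_zero,
    Finset.sum_eq_zero_iff_of_nonneg fun _ _ => by positivity] at hx
  have hz : (x : h →ₗ[ℂ] h) = 0 := (stdOrthonormalBasis ℂ h).toBasis.ext fun i => by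
    simpa using hx i (Finset.mem_univ i)
  ext v
  exact LinearMap.congr_fun hz v

theorem tr_nonneg {x : h →L[ℂ] h} (hx : 0 ≤ x) : 0 ≤ tr x := by
  obtain ⟨y, rfl⟩ := CStarAlgebra.nonneg_iff_eq_star_mul_self.mp hx
  rw [tr_star_mul_self]
  exact_mod_cast Finset.sum_nonneg fun _ _ => by positivity

theorem IsDensity.ne_zero {ρ : h →L[ℂ] h} (hρ : IsDensity ρ) : ρ ≠ 0 := by
  rintro rfl
  simpa [tr_zero] using hρ.2

/-- Exhibits the pairing of two positive operators as a squared Hilbert–Schmidt norm, which makes it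
nonnegative and detects when their product vanishes. -/
theorem tr_mul_star_mul_self (c b : h →L[ℂ] h) :
    tr ((star c * c) * (star b * b)) = tr (star (c * star b) * (c * star b)) := by
  rw [star_mul, star_star, ← mul_assoc, tr_mul_comm]
  simp only [mul_assoc]

theorem tr_mul_nonneg {ρ a : h →L[ℂ] h} (hρ : 0 ≤ ρ) (ha : 0 ≤ a) : 0 ≤ tr (ρ * a) := by
  obtain ⟨c, rfl⟩ := CStarAlgebra.nonneg_iff_eq_star_mul_self.mp hρ
  obtain ⟨b, rfl⟩ := CStarAlgebra.nonneg_iff_eq_star_mul_self.mp ha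
  rw [tr_mul_star_mul_self]
  exact tr_nonneg (star_mul_self_nonneg _)

theorem mul_eq_zero_of_tr_mul_eq_zero {ρ a : h →L[ℂ] h} (hρ : 0 ≤ ρ) (ha : 0 ≤ a)
    (h0 : tr (ρ * a) = 0) : ρ * a = 0 := by
  obtain ⟨c, rfl⟩ := CStarAlgebra.nonneg_iff_eq_star_mul_self.mp hρ
  obtain ⟨b, rfl⟩ := CStarAlgebra.nonneg_iff_eq_star_mul_self.mp ha
  rw [tr_mul_star_mul_self] at h0
  have := tr_star_mul_self_eq_zero h0
  rw [mul_assoc, ← mul_assoc c, this, zero_mul, mul_zero]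

theorem tr_mul_le_tr_mul {ρ a b : h →L[ℂ] h} (hρ : 0 ≤ ρ) (hab : a ≤ b) :
    tr (ρ * a) ≤ tr (ρ * b) := by
  have := tr_mul_nonneg hρ (sub_nonneg.mpr hab)
  rwa [mul_sub, tr_sub, sub_nonneg] at this

/-- A unit `ρ ≥ 0` separates comparable operators. -/
theorem eq_of_le_of_tr_mul_le {ρ a b : h →L[ℂ] h} (hρ : 0 ≤ ρ) (hu : IsUnit ρ) (hab : a ≤ b)
    (hle : tr (ρ * b) ≤ tr (ρ * a)) : a = b := by
  have h0 : tr (ρ * (b - a)) = 0 := by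
    rw [mul_sub, tr_sub, sub_eq_zero]
    exact le_antisymm hle (tr_mul_le_tr_mul hρ hab)
  have := mul_eq_zero_of_tr_mul_eq_zero hρ (sub_nonneg.mpr hab) h0
  exact (sub_eq_zero.mp (hu.mul_right_eq_zero.mp this)).symm

/-- Every linear functional on `B(h)` is given by the trace against an operator. -/
theorem exists_tr_mul_eq (φ : (h →L[ℂ] h) →ₗ[ℂ] ℂ) : ∃ ρ : h →L[ℂ] h, ∀ x, tr (ρ * x) = φ x := by
  let B : (h →L[ℂ] h) →ₗ[ℂ] Module.Dual ℂ (h →L[ℂ] h) :=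
    LinearMap.mk₂ ℂ (fun ρ x => tr (ρ * x)) (by intros; rw [add_mul, tr_add])
      (by intros; rw [smul_mul_assoc, tr_smul, smul_eq_mul]) (by intros; rw [mul_add, tr_add])
      (by intros; rw [mul_smul_comm, tr_smul, smul_eq_mul])
  have hinj : Function.Injective B := by
    rw [← LinearMap.ker_eq_bot, LinearMap.ker_eq_bot']
    intro ρ hρ
    have : tr (ρ * star ρ) = 0 := LinearMap.congr_fun hρ (star ρ)
    exact tr_star_mul_self_eq_zero (by rwa [tr_mul_comm])
  obtain ⟨ρ, hρ⟩ := (LinearMap.injective_iff_surjective_of_finrank_eq_finrank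
    Subspace.dual_finrank_eq.symm).mp hinj φ
  exact ⟨ρ, fun x => LinearMap.congr_fun hρ x⟩

theorem nonneg_of_inner_nonneg {x : h →L[ℂ] h} (hx : ∀ v, 0 ≤ ⟪v, x v⟫_ℂ) : 0 ≤ x := by
  rw [ContinuousLinearMap.nonneg_iff_isPositive, ContinuousLinearMap.isPositive_iff_complex]
  intro v
  obtain ⟨h1, h2⟩ := Complex.nonneg_iff.mp (hx v)
  rw [← inner_conj_symm, Complex.conj_re] at h1
  rw [← inner_conj_symm, Complex.conj_im] at h2
  refine ⟨Complex.ext (by simp) ?_, by simpa using h1⟩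
  simpa using (neg_eq_zero.mp h2.symm).symm

theorem isUnit_of_ker_eq_bot {x : h →L[ℂ] h} (hx : LinearMap.ker (x : h →ₗ[ℂ] h) = ⊥) :
    IsUnit x := by
  have hi := LinearMap.ker_eq_bot.mp hx
  rw [ContinuousLinearMap.isUnit_iff_bijective]
  exact ⟨hi, LinearMap.surjective_of_injective hi⟩

theorem isFaithful_iff_isUnit {ρ : h →L[ℂ] h} : IsFaithful ρ ↔ IsUnit ρ := by
  rw [IsFaithful, (Submodule.closed_of_finiteDimensional _).submodule_topologicalClosure_eq,
    ContinuousLinearMap.isUnit_iff_bijective]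
  constructor
  · intro hr
    have hs := LinearMap.range_eq_top.mp hr
    exact ⟨LinearMap.injective_iff_surjective.mpr hs, hs⟩
  · intro hb
    exact LinearMap.range_eq_top.mpr hb.2

/-! ### Kernel and support projections -/

variable (x : h →L[ℂ] h)

/-- The orthogonal projection onto the kernel of an operator. -/
noncomputable abbrev kerProj (x : h →L[ℂ] h) : h →L[ℂ] h :=
  (LinearMap.ker (x : h →ₗ[ℂ] h)).starProjection

theorem mul_kerProj : x * kerProj x = 0 := by
  ext v
  exact ((LinearMap.ker (x : h →ₗ[ℂ] h)).starProjection_apply_mem v :)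

theorem isStarProjection_kerProj : IsStarProjection (kerProj x) :=
  isStarProjection_starProjection

variable {x}

theorem kerProj_mul_of_mul_eq_zero {y : h →L[ℂ] h} (hxy : x * y = 0) : kerProj x * y = y := by
  ext v
  exact Submodule.starProjection_eq_self_iff.mpr (DFunLike.congr_fun hxy v)

/-- A positive contraction whose range lies in that of a projection lies below it. -/
theorem le_of_isStarProjection_mul_eq {p y : h →L[ℂ] h} (hp : IsStarProjection p) (hy : 0 ≤ y)
    (hy1 : y ≤ 1) (h1 : p * y = y) : y ≤ p := by
  have h2 : y * p = y := by
    have := congrArg star h1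
    rwa [star_mul, hp.isSelfAdjoint.star_eq, (IsSelfAdjoint.of_nonneg hy).star_eq] at this
  have := star_left_conjugate_le_conjugate hy1 p
  rwa [hp.isSelfAdjoint.star_eq, h1, h2, mul_one, hp.isIdempotentElem.eq] at this

/-- An effect annihilated by `x` lies below the projection onto the kernel of `x`. -/
theorem le_kerProj {y : h →L[ℂ] h} (hy : 0 ≤ y) (hy1 : y ≤ 1) (hxy : x * y = 0) :
    y ≤ kerProj x :=
  le_of_isStarProjection_mul_eq (isStarProjection_kerProj x) hy hy1
    (kerProj_mul_of_mul_eq_zero hxy)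

theorem kerProj_eq_one_iff : kerProj x = 1 ↔ x = 0 := by
  constructor
  · intro hk
    simpa [hk] using mul_kerProj x
  · rintro rfl
    ext v
    exact Submodule.starProjection_eq_self_iff.mpr (by simp)

theorem isUnit_of_kerProj_eq_zero (hk : kerProj x = 0) : IsUnit x := by
  refine isUnit_of_ker_eq_bot ((Submodule.eq_bot_iff _).mpr fun v hv => ?_)
  rw [← Submodule.starProjection_eq_self_iff.mpr hv]
  exact DFunLike.congr_fun hk v

/-- A positive operator dominates a positive multiple of its support projection. -/
theorem exists_smul_one_sub_kerProj_le [Nontrivial h] (hx : 0 ≤ x) :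
    ∃ ε : ℝ, 0 < ε ∧ (ε : ℂ) • (1 - kerProj x) ≤ x := by
  set q := kerProj x
  have hq : IsStarProjection q := isStarProjection_kerProj x
  have hxq : x * q = 0 := mul_kerProj x
  have hqx : q * x = 0 := by
    have := congrArg star hxq
    rwa [star_mul, hq.isSelfAdjoint.star_eq, (IsSelfAdjoint.of_nonneg hx).star_eq, star_zero]
      at this
  -- Adding `q` fills the kernel, so `x + q` is bounded below by some `ε > 0`; compressing by `1 -
  -- q` removes `q` again.
  have hnn : 0 ≤ x + q := add_nonneg hx hq.nonneg
  have hu : IsUnit (x + q) := by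
    refine isUnit_of_ker_eq_bot ((Submodule.eq_bot_iff _).mpr fun v hv => ?_)
    have hv : (x + q) v = 0 := hv
    have h1 : q v = 0 := by
      have : (q * (x + q)) v = 0 := by simp [hv]
      rwa [mul_add, hqx, hq.isIdempotentElem.eq, zero_add] at this
    have h2 : x v = 0 := by simpa [h1] using hv
    rw [← h1]
    exact (Submodule.starProjection_eq_self_iff.mpr h2).symm
  obtain ⟨ε, hε, hle⟩ := (CFC.exists_pos_algebraMap_le_iff (IsSelfAdjoint.of_nonneg hnn)).mpr
    (fun r hr => lt_of_le_of_ne (spectrum_nonneg_of_nonneg hnn hr) (by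
      rintro rfl
      exact spectrum.zero_notMem ℝ hu hr))
  refine ⟨ε, hε, ?_⟩
  have hp := hq.one_sub
  have := star_left_conjugate_le_conjugate hle (1 - q)
  rw [hp.isSelfAdjoint.star_eq] at this
  have e1 : (1 - q) * (x + q) * (1 - q) = x := by
    have hqq := hq.isIdempotentElem.eq
    simp [mul_add, sub_mul, mul_sub, hqx, hxq, hqq]
  have e2 : (1 - q) * algebraMap ℝ (h →L[ℂ] h) ε * (1 - q) = (ε : ℂ) • (1 - q) := by
    rw [Algebra.algebraMap_eq_smul_one, mul_smul_comm, mul_one, smul_mul_assoc,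
      hp.isIdempotentElem.eq]
    ext v; simp
  rwa [e1, e2] at this

end QuantumMarkov

/-! ### Time averages and invariant densities -/

namespace QuantumMarkov.QMS

open MeasureTheory Filter

variable {h : Type*} [NormedAddCommGroup h] [InnerProductSpace ℂ h] [CompleteSpace h]
  [FiniteDimensional ℂ h] (T : QMS h)

theorem continuous_tr_mul_map (η x : h →L[ℂ] h) : Continuous fun t : ℝ≥0 => tr (η * T.map t x) := by
  have h1 : Continuous (fun (t : ℝ≥0) (η : h →L[ℂ] h) => tr (η * T.map t x)) :=
    continuous_induced_rng.mp (T.weakStar_continuous x)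
  exact (continuous_pi_iff.mp h1) η

theorem map_nonneg (t : ℝ≥0) {x : h →L[ℂ] h} (hx : 0 ≤ x) : 0 ≤ T.map t x :=
  _root_.map_nonneg (T.map t) hx

theorem map_mono (t : ℝ≥0) {x y : h →L[ℂ] h} (hxy : x ≤ y) : T.map t x ≤ T.map t y :=
  OrderHomClass.mono (T.map t) hxy

theorem schwarz (t : ℝ≥0) (x : h →L[ℂ] h) :
    star (T.map t x) * T.map t x ≤ T.map t (star x * x) :=
  (T.map t).star_map_mul_map_le (T.map_one t) x

/-- By Schwarz and unitality, `star (T.map t x) * T.map t x` is at most the scalar `‖x‖²`; the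
C*-identity then gives contractivity. -/
theorem norm_map_le [Nontrivial h] (t : ℝ≥0) (x : h →L[ℂ] h) : ‖T.map t x‖ ≤ ‖x‖ := by
  have h1 : star x * x ≤ algebraMap ℝ (h →L[ℂ] h) ‖star x * x‖ :=
    (IsSelfAdjoint.star_mul_self x).le_algebraMap_norm_self
  have h2 : T.map t (algebraMap ℝ (h →L[ℂ] h) ‖star x * x‖) =
      algebraMap ℝ (h →L[ℂ] h) ‖star x * x‖ := by
    have : algebraMap ℝ (h →L[ℂ] h) ‖star x * x‖ = ((‖star x * x‖ : ℝ) : ℂ) • 1 := by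
      ext v; simp [Algebra.algebraMap_eq_smul_one]
    rw [this, map_smul, T.map_one]
  have h3 := (T.schwarz t x).trans (T.map_mono t h1)
  rw [h2] at h3
  have h4 := CStarAlgebra.norm_le_norm_of_nonneg_of_le (star_mul_self_nonneg _) h3
  rw [norm_algebraMap, norm_one, mul_one, norm_norm, CStarRing.norm_star_mul_self,
    CStarRing.norm_star_mul_self] at h4
  nlinarith [norm_nonneg x, norm_nonneg (T.map t x)]

/-- The expectation of `x` at time `t ≥ 0` in the pure state `v`, as a function of a real time. -/
noncomputable def expectation (v : h) (x : h →L[ℂ] h) (t : ℝ) : ℂ := ⟪v, T.map t.toNNReal x v⟫_ℂ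

theorem continuous_expectation (v : h) (x : h →L[ℂ] h) : Continuous (T.expectation v x) := by
  have h1 := (T.continuous_tr_mul_map (InnerProductSpace.rankOne ℂ v v) x).comp
    continuous_real_toNNReal
  refine h1.congr fun t => ?_
  simp only [Function.comp]
  rw [tr_mul_comm, tr_mul_rankOne, expectation]

theorem norm_expectation_le [Nontrivial h] {v : h} (hv : ‖v‖ = 1) (x : h →L[ℂ] h) (t : ℝ) :
    ‖T.expectation v x t‖ ≤ ‖x‖ := by
  refine (norm_inner_le_norm _ _).trans ?_
  rw [hv, one_mul]
  refine (ContinuousLinearMap.le_opNorm _ _).trans ?_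
  rw [hv, mul_one]
  exact T.norm_map_le _ x

theorem expectation_nonneg (v : h) {x : h →L[ℂ] h} (hx : 0 ≤ x) (t : ℝ) :
    0 ≤ T.expectation v x t :=
  ((ContinuousLinearMap.nonneg_iff_isPositive _).mp (T.map_nonneg _ hx)).inner_nonneg_right v

theorem expectation_add (v : h) (x y : h →L[ℂ] h) :
    T.expectation v (x + y) = T.expectation v x + T.expectation v y := by
  ext t; simp [expectation]

theorem expectation_smul (v : h) (c : ℂ) (x : h →L[ℂ] h) :
    T.expectation v (c • x) = c • T.expectation v x := by
  ext t; simp [expectation]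

theorem expectation_map (v : h) (s : ℝ≥0) (x : h →L[ℂ] h) {t : ℝ} (ht : 0 ≤ t) :
    T.expectation v (T.map s x) t = T.expectation v x (t + s) := by
  rw [expectation, expectation, ← T.map_add, Real.toNNReal_add ht s.coe_nonneg, Real.toNNReal_coe]

/-- The time average of the expectation of `x` over `[0, n + 1]`. -/
noncomputable def timeAverage (v : h) (n : ℕ) (x : h →L[ℂ] h) : ℂ :=
  -- The horizon `n + 1` avoids an empty interval at `n = 0`.
  ((n : ℂ) + 1)⁻¹ * ∫ t in (0 : ℝ)..(n + 1), T.expectation v x t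

theorem intervalIntegrable_expectation (v : h) (x : h →L[ℂ] h) (a b : ℝ) :
    IntervalIntegrable (T.expectation v x) volume a b :=
  (T.continuous_expectation v x).intervalIntegrable a b

theorem timeAverage_add (v : h) (n : ℕ) (x y : h →L[ℂ] h) :
    T.timeAverage v n (x + y) = T.timeAverage v n x + T.timeAverage v n y := by
  rw [timeAverage, T.expectation_add]
  simp only [Pi.add_apply]
  rw [intervalIntegral.integral_add (T.intervalIntegrable_expectation v x _ _)
    (T.intervalIntegrable_expectation v y _ _), mul_add]
  rfl

theorem timeAverage_smul (v : h) (n : ℕ) (c : ℂ) (x : h →L[ℂ] h) :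
    T.timeAverage v n (c • x) = c * T.timeAverage v n x := by
  rw [timeAverage, T.expectation_smul]
  simp only [Pi.smul_apply]
  rw [intervalIntegral.integral_smul, smul_eq_mul, timeAverage]
  ring

theorem timeAverage_nonneg (v : h) (n : ℕ) {x : h →L[ℂ] h} (hx : 0 ≤ x) :
    0 ≤ T.timeAverage v n x := by
  have h1 : ∀ t, T.expectation v x t = (((T.expectation v x t).re : ℝ) : ℂ) := fun t =>
    Complex.ext (by simp) (by
      simpa using (Complex.nonneg_iff.mp (T.expectation_nonneg v hx t)).2.symm)
  rw [timeAverage, intervalIntegral.integral_congr (fun t _ => h1 t),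
    intervalIntegral.integral_ofReal]
  have h2 : 0 ≤ ∫ t in (0 : ℝ)..(n + 1), (T.expectation v x t).re :=
    intervalIntegral.integral_nonneg (by positivity)
      fun t _ => (Complex.nonneg_iff.mp (T.expectation_nonneg v hx t)).1
  have : 0 ≤ ((n : ℝ) + 1)⁻¹ * ∫ t in (0 : ℝ)..(n + 1), (T.expectation v x t).re := by positivity
  have h3 := Complex.zero_le_real.mpr this
  push_cast at h3
  exact h3

theorem norm_timeAverage_le [Nontrivial h] {v : h} (hv : ‖v‖ = 1) (n : ℕ) (x : h →L[ℂ] h) :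
    ‖T.timeAverage v n x‖ ≤ ‖x‖ := by
  have h1 := intervalIntegral.norm_integral_le_of_norm_le_const (a := 0) (b := (n : ℝ) + 1)
    fun t _ => T.norm_expectation_le hv x t
  have h2 : (0 : ℝ) < (n : ℝ) + 1 := by positivity
  have h3 : ‖((n : ℂ) + 1)⁻¹‖ = ((n : ℝ) + 1)⁻¹ := by
    rw [norm_inv]; norm_cast
  rw [sub_zero, abs_of_pos h2] at h1
  rw [timeAverage, norm_mul, h3, inv_mul_le_iff₀ h2, mul_comm]
  exact h1

/-- Evolving `x` by `s` shifts the window of integration by `s`. The two windows differ by two end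
pieces of length `s`, negligible after division by `n + 1`. -/
theorem tendsto_timeAverage_map_sub [Nontrivial h] {v : h} (hv : ‖v‖ = 1) (s : ℝ≥0)
    (x : h →L[ℂ] h) :
    Tendsto (fun n => T.timeAverage v n (T.map s x) - T.timeAverage v n x) atTop (𝓝 0) := by
  have hint := T.intervalIntegrable_expectation v x
  have key : ∀ n : ℕ, ‖T.timeAverage v n (T.map s x) - T.timeAverage v n x‖ ≤
      (2 * ‖x‖ * s) * (1 / ((n : ℝ) + 1)) := by
    intro n
    have h2 : (0 : ℝ) < (n : ℝ) + 1 := by positivity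
    have h3 : ‖((n : ℂ) + 1)⁻¹‖ = ((n : ℝ) + 1)⁻¹ := by
      rw [norm_inv]; norm_cast
    have h4 : ∫ t in (0 : ℝ)..(n + 1), T.expectation v (T.map s x) t =
        ∫ t in (s : ℝ)..(n + 1 + s), T.expectation v x t := by
      have : ∫ t in (0 : ℝ)..(n + 1), T.expectation v (T.map s x) t =
          ∫ t in (0 : ℝ)..(n + 1), T.expectation v x (t + s) :=
        intervalIntegral.integral_congr fun t ht => T.expectation_map v s x (by
          rw [Set.uIcc_of_le h2.le] at ht
          exact ht.1)
      rw [this, intervalIntegral.integral_comp_add_right, zero_add]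
    have h5 : (∫ t in (s : ℝ)..(n + 1 + s), T.expectation v x t) -
        (∫ t in (0 : ℝ)..(n + 1), T.expectation v x t) =
        (∫ t in ((n : ℝ) + 1)..(n + 1 + s), T.expectation v x t) -
        ∫ t in (0 : ℝ)..s, T.expectation v x t := by
      rw [← intervalIntegral.integral_add_adjacent_intervals (hint 0 s) (hint s (n + 1)),
        ← intervalIntegral.integral_add_adjacent_intervals (hint s (n + 1))
          (hint (n + 1) (n + 1 + s))]
      ring
    have h6 := intervalIntegral.norm_integral_le_of_norm_le_const (a := 0) (b := (s : ℝ))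
      fun t _ => T.norm_expectation_le hv x t
    have h7 := intervalIntegral.norm_integral_le_of_norm_le_const (a := (n : ℝ) + 1)
      (b := (n : ℝ) + 1 + s) fun t _ => T.norm_expectation_le hv x t
    rw [sub_zero, abs_of_nonneg s.coe_nonneg] at h6
    rw [add_sub_cancel_left, abs_of_nonneg s.coe_nonneg] at h7
    rw [timeAverage, timeAverage, ← mul_sub, h4, h5, norm_mul, h3, one_div, mul_comm]
    refine mul_le_mul_of_nonneg_right ?_ (inv_nonneg.mpr h2.le)
    refine (norm_sub_le _ _).trans ?_
    linarith
  refine squeeze_zero_norm key ?_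
  simpa using tendsto_one_div_add_atTop_nhds_zero_nat.const_mul (2 * ‖x‖ * (s : ℝ))

/-- Every nonzero subharmonic projection supports an invariant density. -/
theorem exists_invariant_density_of_subharmonic [Nontrivial h] {p : h →L[ℂ] h}
    (hp : IsStarProjection p) (hp0 : p ≠ 0) (hsub : ∀ t, p ≤ T.map t p) :
    ∃ ρ, IsDensity ρ ∧ T.IsInvariant ρ ∧ tr (ρ * (1 - p)) = 0 := by
  obtain ⟨v, hv, hpv⟩ : ∃ v : h, ‖v‖ = 1 ∧ p v = v := by
    obtain ⟨w, hw⟩ : ∃ w, p w ≠ 0 := by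
      by_contra! hall
      exact hp0 (ContinuousLinearMap.ext hall)
    refine ⟨((‖p w‖ : ℂ)⁻¹) • p w, ?_, ?_⟩
    · rw [norm_smul, norm_inv, Complex.norm_real, norm_norm]
      exact inv_mul_cancel₀ (norm_ne_zero_iff.mpr hw)
    · rw [map_smul]
      congr 1
      exact DFunLike.congr_fun hp.isIdempotentElem.eq w
  -- A free ultrafilter yields limits for all `x` simultaneously, so the limit functional is linear.
  let U : Ultrafilter ℕ := hyperfilter ℕ
  have hU : (U : Filter ℕ) ≤ atTop := by
    rw [← Nat.cofinite_eq_atTop]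
    exact hyperfilter_le_cofinite
  have hlim : ∀ x, ∃ z, Tendsto (fun n => T.timeAverage v n x) U (𝓝 z) := by
    intro x
    obtain ⟨z, -, hz⟩ := (isCompact_closedBall (0 : ℂ) ‖x‖).ultrafilter_le_nhds
      (U.map fun n => T.timeAverage v n x) (by
        rw [le_principal_iff, Ultrafilter.coe_map, mem_map]
        exact Filter.univ_mem' fun n =>
          mem_closedBall_zero_iff.mpr (T.norm_timeAverage_le hv n x))
    exact ⟨z, hz⟩
  choose φ hφ using hlim
  let Λ : (h →L[ℂ] h) →ₗ[ℂ] ℂ :=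
    { toFun := φ
      map_add' := fun x y => tendsto_nhds_unique (hφ (x + y)) (by
        simpa only [T.timeAverage_add] using (hφ x).add (hφ y))
      map_smul' := fun c x => tendsto_nhds_unique (hφ (c • x)) (by
        simpa only [T.timeAverage_smul, RingHom.id_apply, smul_eq_mul] using (hφ x).const_mul c) }
  have hconst : ∀ x c, (∀ t, T.expectation v x t = c) → φ x = c := fun x c hx => by
    refine tendsto_nhds_unique (hφ x) (tendsto_const_nhds.congr fun n => ?_)
    have : (n : ℂ) + 1 ≠ 0 := by norm_cast
    simp only [timeAverage, hx, intervalIntegral.integral_const, sub_zero, Complex.real_smul]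
    push_cast
    field_simp
  have hpos : ∀ x, 0 ≤ x → 0 ≤ φ x := fun x hx =>
    ge_of_tendsto' (hφ x) fun n => T.timeAverage_nonneg v n hx
  have hinv : ∀ s x, φ (T.map s x) = φ x := fun s x => sub_eq_zero.mp
    (tendsto_nhds_unique ((hφ (T.map s x)).sub (hφ x))
      ((T.tendsto_timeAverage_map_sub hv s x).mono_left hU))
  obtain ⟨ρ, hρ⟩ := exists_tr_mul_eq Λ
  change ∀ x, tr (ρ * x) = φ x at hρ
  refine ⟨ρ, ⟨nonneg_of_inner_nonneg fun w => ?_, ?_⟩, fun t x => ?_, ?_⟩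
  · rw [← tr_mul_rankOne, hρ]
    exact hpos _ ((ContinuousLinearMap.nonneg_iff_isPositive _).mpr
      (InnerProductSpace.isPositive_rankOne_self w))
  · rw [← mul_one ρ, hρ]
    refine hconst _ _ fun t => ?_
    simp [expectation, T.map_one, inner_self_eq_norm_sq_to_K, hv]
  · rw [hρ, hρ, hinv]
  · rw [hρ]
    -- `1 - p` decreases under the semigroup and has zero expectation in `v`, which lies in the
    -- range of `p`.
    refine hconst _ _ fun t => le_antisymm ?_ (T.expectation_nonneg v hp.one_sub.nonneg t)
    have h1 : T.map t.toNNReal (1 - p) ≤ 1 - p := by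
      rw [map_sub, T.map_one]
      exact sub_le_sub_left (hsub _) 1
    have h2 := ((ContinuousLinearMap.nonneg_iff_isPositive _).mp
      (sub_nonneg.mpr h1)).inner_nonneg_right v
    simpa [expectation, inner_sub_right, hpv] using h2

end QuantumMarkov.QMS

/-! ### Common eigenvectors -/

/-- A commuting family of endomorphisms has a common eigenvector in every nonzero invariant
subspace of a finite-dimensional complex vector space. -/
theorem Module.End.exists_common_eigenvector {ι V : Type*} [AddCommGroup V] [Module ℂ V]
    [FiniteDimensional ℂ V] (f : ι → Module.End ℂ V) (hf : ∀ i j, Commute (f i) (f j))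
    (W : Submodule ℂ V) (hW : W ≠ ⊥) (hinv : ∀ i, ∀ x ∈ W, f i x ∈ W) :
    ∃ x ∈ W, x ≠ 0 ∧ ∀ i, ∃ c : ℂ, f i x = c • x := by
  let S : Set (Submodule ℂ V) := {W' | W' ≤ W ∧ W' ≠ ⊥ ∧ ∀ i, ∀ x ∈ W', f i x ∈ W'}
  obtain ⟨M, ⟨hMW, hM0, hMinv⟩, hmin⟩ :=
    wellFounded_lt.has_min S ⟨W, le_rfl, hW, hinv⟩
  obtain ⟨x, hxM, hx0⟩ := Submodule.exists_mem_ne_zero_of_ne_bot hM0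
  refine ⟨x, hMW hxM, hx0, fun i => ?_⟩
  have : Nontrivial M := Submodule.nontrivial_iff_ne_bot.mpr hM0
  obtain ⟨c, hc⟩ := Module.End.exists_eigenvalue ((f i).restrict (hMinv i))
  obtain ⟨w, hw⟩ := hc.exists_hasEigenvector
  have hwc : f i (w : V) = c • (w : V) := congrArg Subtype.val hw.apply_eq_smul
  -- By commutation each eigenspace of `f i` in the minimal subspace `M` is invariant, so a nonzero
  -- one is all of `M`.
  have hmem : M ⊓ Module.End.eigenspace (f i) c ∈ S := by
    refine ⟨inf_le_left.trans hMW, ?_, fun j y hy => ⟨hMinv j y hy.1, ?_⟩⟩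
    · refine Submodule.ne_bot_iff _ |>.mpr ⟨w, ⟨w.2, Module.End.mem_eigenspace_iff.mpr hwc⟩, ?_⟩
      exact fun h0 => hw.2 (Subtype.ext h0)
    · refine Module.End.mem_eigenspace_iff.mpr ?_
      have h1 : f i (f j y) = f j (f i y) := LinearMap.congr_fun (hf i j) y
      rw [h1, Module.End.mem_eigenspace_iff.mp hy.2, map_smul]
  have hle : M ≤ M ⊓ Module.End.eigenspace (f i) c := by
    by_contra hne
    exact hmin _ hmem (lt_of_le_of_ne inf_le_left fun h0 => hne h0.ge)
  exact ⟨c, Module.End.mem_eigenspace_iff.mp (hle hxM).2⟩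

/-! ### Consequences of irreducibility -/

namespace QuantumMarkov.QMS

variable {h : Type*} [NormedAddCommGroup h] [InnerProductSpace ℂ h] [CompleteSpace h]
  [FiniteDimensional ℂ h] {T : QMS h}

theorem map_le_one {x : h →L[ℂ] h} (hx : x ≤ 1) (t : ℝ≥0) : T.map t x ≤ 1 :=
  (T.map_mono t hx).trans_eq (T.map_one t)

theorem IsInvariant.sub {ρ σ : h →L[ℂ] h} (hρ : T.IsInvariant ρ) (hσ : T.IsInvariant σ) :
    T.IsInvariant (ρ - σ) := fun t x => by
  rw [sub_mul, sub_mul, tr_sub, tr_sub, hρ, hσ]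

theorem IsInvariant.smul {ρ : h →L[ℂ] h} (hρ : T.IsInvariant ρ) (c : ℂ) :
    T.IsInvariant (c • ρ) := fun t x => by
  rw [smul_mul_assoc, smul_mul_assoc, tr_smul, tr_smul, hρ]

/-- The support projection of an invariant positive operator is subharmonic. -/
theorem IsIrreducible.eq_zero_or_isUnit_of_isInvariant (hT : T.IsIrreducible) {τ : h →L[ℂ] h}
    (hτ : 0 ≤ τ) (hinv : T.IsInvariant τ) : τ = 0 ∨ IsUnit τ := by
  have hq := isStarProjection_kerProj τ
  -- Invariance gives `τ` zero pairing with the evolved kernel projection, which therefore stays in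
  -- the kernel.
  have hsub : ∀ t, T.map t (kerProj τ) ≤ kerProj τ := fun t => by
    refine le_kerProj (T.map_nonneg t hq.nonneg) (map_le_one hq.le_one t)
      (mul_eq_zero_of_tr_mul_eq_zero hτ (T.map_nonneg t hq.nonneg) ?_)
    rw [hinv, mul_kerProj, tr_zero]
  rcases hT (1 - kerProj τ) hq.one_sub (fun t => by
    rw [map_sub, T.map_one]
    exact sub_le_sub_left (hsub t) 1) with h0 | h1
  · exact Or.inl (kerProj_eq_one_iff.mp (sub_eq_zero.mp h0).symm)
  · exact Or.inr (isUnit_of_kerProj_eq_zero (by simpa using h1))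

/-- The kernel projection of a positive fixed point is subharmonic. -/
theorem IsIrreducible.eq_zero_or_isUnit_of_fixed [Nontrivial h] (hT : T.IsIrreducible)
    {y : h →L[ℂ] h} (hy : 0 ≤ y) (hfix : ∀ t, T.map t y = y) : y = 0 ∨ IsUnit y := by
  have hq := isStarProjection_kerProj y
  obtain ⟨ε, hε, hle⟩ := exists_smul_one_sub_kerProj_le hy
  have hsub : ∀ t, kerProj y ≤ T.map t (kerProj y) := fun t => by
    have hp := hq.one_sub
    have h1 := T.map_mono t hle
    rw [map_smul, hfix] at h1
    have h2 : 0 ≤ kerProj y * T.map t (1 - kerProj y) * kerProj y := by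
      have := star_left_conjugate_nonneg (T.map_nonneg t hp.nonneg) (kerProj y)
      rwa [hq.isSelfAdjoint.star_eq] at this
    -- `ε • (1 - kerProj y) ≤ y` is preserved up to replacing the left side by its evolution;
    -- compressing to the kernel kills `y`.
    have h3 : kerProj y * T.map t (1 - kerProj y) * kerProj y ≤ 0 := by
      have := star_left_conjugate_le_conjugate h1 (kerProj y)
      rw [hq.isSelfAdjoint.star_eq, mul_assoc _ y, mul_kerProj, mul_zero, mul_smul_comm,
        smul_mul_assoc] at this
      have h4 := smul_le_smul_of_nonneg_left this (inv_nonneg.mpr hε.le)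
      rw [smul_zero] at h4
      convert h4 using 1
      ext v
      simp [hε.ne']
    have h5 : tr (kerProj y * T.map t (1 - kerProj y)) = 0 := by
      have h4 := congrArg tr (le_antisymm h3 h2)
      rwa [tr_mul_comm, ← mul_assoc, hq.isIdempotentElem.eq, tr_zero] at h4
    have h6 := mul_eq_zero_of_tr_mul_eq_zero hq.nonneg (T.map_nonneg t hp.nonneg) h5
    have h7 := le_of_isStarProjection_mul_eq hp (T.map_nonneg t hp.nonneg)
      (map_le_one hp.le_one t) (by rw [sub_mul, h6, one_mul, sub_zero])
    rw [map_sub, T.map_one] at h7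
    exact (sub_le_sub_iff_left 1).mp h7
  rcases hT _ hq hsub with h0 | h1
  · exact Or.inr (isUnit_of_kerProj_eq_zero h0)
  · exact Or.inl (kerProj_eq_one_iff.mp h1)

/-- Take the largest `s` with `s σ ≤ ρ`. The invariant difference is zero or invertible; if zero,
traces give `s = 1`, and if invertible, `s` could be increased. -/
theorem IsIrreducible.invariant_density_unique [Nontrivial h] (hT : T.IsIrreducible)
    {ρ σ : h →L[ℂ] h} (hρ : IsDensity ρ) (hσ : IsDensity σ) (hρi : T.IsInvariant ρ)
    (hσi : T.IsInvariant σ) : σ = ρ := by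
  let S : Set ℝ := {s | 0 ≤ s ∧ (s : ℂ) • σ ≤ ρ}
  have hclosed : IsClosed S := by
    have h1 : IsClosed {s : ℝ | (s : ℂ) • σ ≤ ρ} := isClosed_le (by fun_prop) continuous_const
    exact isClosed_Ici.inter h1
  have hbdd : S ⊆ Set.Icc 0 1 := fun s hs => ⟨hs.1, by
    have := tr_nonneg (sub_nonneg.mpr hs.2)
    rw [tr_sub, tr_smul, hρ.2, hσ.2, mul_one, sub_nonneg] at this
    exact_mod_cast this⟩
  obtain ⟨s, hs, hmax⟩ := (isCompact_Icc.of_isClosed_subset hclosed hbdd).exists_isGreatest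
    ⟨0, le_rfl, by simpa using hρ.1⟩
  rcases hT.eq_zero_or_isUnit_of_isInvariant (sub_nonneg.mpr hs.2) (hρi.sub (hσi.smul s)) with
    h0 | hu
  · have h1 := congrArg tr h0
    rw [tr_sub, tr_smul, hρ.2, hσ.2, mul_one, tr_zero, sub_eq_zero] at h1
    rw [← h1, one_smul, sub_eq_zero] at h0
    exact h0.symm
  · exfalso
    obtain ⟨ε, hε, hle⟩ := exists_smul_one_sub_kerProj_le (sub_nonneg.mpr hs.2)
    have hk : kerProj (ρ - (s : ℂ) • σ) = 0 :=
      hu.mul_right_eq_zero.mp (mul_kerProj (ρ - (s : ℂ) • σ))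
    rw [hk, sub_zero] at hle
    have hσn : σ ≤ (‖σ‖ : ℂ) • 1 := by
      have h1 := (IsSelfAdjoint.of_nonneg hσ.1).le_algebraMap_norm_self
      convert h1 using 1
      ext v; simp [Algebra.algebraMap_eq_smul_one]
    have hpos : 0 < ‖σ‖ := norm_pos_iff.mpr hσ.ne_zero
    -- Since `σ ≤ ‖σ‖`, the extra multiple of `σ` is at most `ε`, hence at most `ρ - s σ`.
    have hmem : s + ε / ‖σ‖ ∈ S := by
      refine ⟨add_nonneg hs.1 (by positivity), ?_⟩
      have h2 : ((ε / ‖σ‖ : ℝ) : ℂ) • σ ≤ (ε : ℂ) • 1 := by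
        have h3 := smul_le_smul_of_nonneg_left hσn (show 0 ≤ ε / ‖σ‖ by positivity)
        rw [← Complex.coe_smul, ← Complex.coe_smul, smul_smul, ← Complex.ofReal_mul,
          div_mul_cancel₀ _ hpos.ne'] at h3
        exact h3
      rw [Complex.ofReal_add, add_smul]
      have h4 := add_le_add_right (h2.trans hle) ((s : ℂ) • σ)
      simpa using h4
    have := hmax hmem
    have : 0 < ε / ‖σ‖ := by positivity
    linarith

/-! ### Fixed points of a single map -/

section FaithfulInvariant

variable {ρ : h →L[ℂ] h}

theorem map_nsmul_of_map_eq {t₀ : ℝ≥0} {x : h →L[ℂ] h} (hx : T.map t₀ x = x) (k : ℕ) :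
    T.map (k • t₀) x = x := by
  induction k with
  | zero => rw [zero_smul, T.map_zero]
  | succ k ih => rw [succ_nsmul, T.map_add, hx, ih]

/-- Equality in the Schwarz inequality on the fixed points of one map of the semigroup. -/
theorem map_star_mul_self (hρ : 0 ≤ ρ) (hu : IsUnit ρ) (hinv : T.IsInvariant ρ) {t₀ : ℝ≥0}
    (ht₀ : 0 < t₀) {x : h →L[ℂ] h} (hx : T.map t₀ x = x) (t : ℝ≥0) :
    T.map t (star x * x) = star (T.map t x) * T.map t x := by
  obtain ⟨k, hk⟩ := Archimedean.arch t ht₀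
  -- Running on to the multiple `k • t₀ ≥ t` returns `T.map t x` to `x`. Schwarz on both legs,
  -- paired with `ρ`, sandwiches the defect to zero.
  have hback : T.map (k • t₀ - t) (T.map t x) = x := by
    rw [← T.map_add, tsub_add_cancel_of_le hk, map_nsmul_of_map_eq hx]
  refine (eq_of_le_of_tr_mul_le hρ hu (T.schwarz t x) ?_).symm
  rw [hinv t (star x * x), ← hinv (k • t₀ - t) (star (T.map t x) * T.map t x)]
  have := tr_mul_le_tr_mul hρ (T.schwarz (k • t₀ - t) (T.map t x))
  rwa [hback] at this

/-- Polarization: the equality case for `x + y` and for `x + i y` gives the sum and the difference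
of the two cross defects. -/
theorem map_star_mul (hρ : 0 ≤ ρ) (hu : IsUnit ρ) (hinv : T.IsInvariant ρ) {t₀ : ℝ≥0}
    (ht₀ : 0 < t₀) {x y : h →L[ℂ] h} (hx : T.map t₀ x = x) (hy : T.map t₀ y = y) (t : ℝ≥0) :
    T.map t (star y * x) = star (T.map t y) * T.map t x := by
  have hxx := map_star_mul_self hρ hu hinv ht₀ hx t
  have hyy := map_star_mul_self hρ hu hinv ht₀ hy t
  have h1 := map_star_mul_self hρ hu hinv ht₀ (x := x + y) (by rw [_root_.map_add, hx, hy]) t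
  have h2 := map_star_mul_self hρ hu hinv ht₀ (x := x + Complex.I • y)
    (by rw [_root_.map_add, map_smul, hx, hy]) t
  simp only [star_add, star_smul, add_mul, mul_add, _root_.map_add, map_smul, smul_mul_assoc,
    mul_smul_comm, hxx, hyy, smul_add, smul_smul, RCLike.star_def, Complex.conj_I] at h1 h2
  generalize T.map t (star y * x) = a at *
  generalize T.map t (star x * y) = b at *
  have e1 : (a - star (T.map t y) * T.map t x) + (b - star (T.map t x) * T.map t y) = 0 := by
    linear_combination (norm := module) h1
  have e2 : (-Complex.I) • (a - star (T.map t y) * T.map t x) +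
      Complex.I • (b - star (T.map t x) * T.map t y) = 0 := by
    rw [smul_sub, smul_sub]
    linear_combination (norm := module) h2
  have e3 : Complex.I • ((b - star (T.map t x) * T.map t y) -
      (a - star (T.map t y) * T.map t x)) = 0 := by
    linear_combination (norm := module) e2
  have e4 := (smul_eq_zero.mp e3).resolve_left Complex.I_ne_zero
  have e5 : (2 : ℂ) • (a - star (T.map t y) * T.map t x) = 0 := by
    linear_combination (norm := module) e1 - e4
  exact sub_eq_zero.mp ((smul_eq_zero.mp e5).resolve_left two_ne_zero)

theorem map_mul_of_fixed (hρ : 0 ≤ ρ) (hu : IsUnit ρ) (hinv : T.IsInvariant ρ) {t₀ : ℝ≥0}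
    (ht₀ : 0 < t₀) {x y : h →L[ℂ] h} (hx : T.map t₀ x = x) (hy : T.map t₀ y = y) (t : ℝ≥0) :
    T.map t (y * x) = T.map t y * T.map t x := by
  have := map_star_mul hρ hu hinv ht₀ hx (y := star y) (by rw [map_star, hy]) t
  rwa [map_star, star_star, star_star] at this

theorem map_aeval_of_fixed (hρ : 0 ≤ ρ) (hu : IsUnit ρ) (hinv : T.IsInvariant ρ) {t₀ : ℝ≥0}
    (ht₀ : 0 < t₀) {x : h →L[ℂ] h} (hx : T.map t₀ x = x) (t : ℝ≥0) (f : Polynomial ℂ) :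
    T.map t (Polynomial.aeval x f) = Polynomial.aeval (T.map t x) f := by
  -- Both claims go in one induction: multiplicativity needs `x ^ n` to be fixed by `T.map t₀`.
  have hpow : ∀ n : ℕ, T.map t₀ (x ^ n) = x ^ n ∧ T.map t (x ^ n) = T.map t x ^ n := by
    intro n
    induction n with
    | zero => simp [T.map_one]
    | succ n ih =>
      rw [pow_succ, pow_succ, map_mul_of_fixed hρ hu hinv ht₀ hx ih.1,
        map_mul_of_fixed hρ hu hinv ht₀ hx ih.1, ih.1, ih.2, hx]
      exact ⟨rfl, rfl⟩
  rw [Polynomial.aeval_eq_sum_range, Polynomial.aeval_eq_sum_range, map_sum]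
  exact Finset.sum_congr rfl fun n _ => by rw [map_smul, (hpow n).2]

theorem exists_apply_eq_smul [Nontrivial h] (x : h →L[ℂ] h) :
    ∃ (μ : ℂ) (v : h), v ≠ 0 ∧ x v = μ • v := by
  obtain ⟨μ, hμ⟩ := Module.End.exists_eigenvalue (x : h →ₗ[ℂ] h)
  obtain ⟨v, hv⟩ := hμ.exists_hasEigenvector
  exact ⟨μ, v, hv.2, hv.apply_eq_smul⟩

/-- The fixed points of an irreducible semigroup are the scalars. -/
theorem IsIrreducible.exists_eq_smul_one [Nontrivial h] (hT : T.IsIrreducible) (hρ : 0 ≤ ρ)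
    (hu : IsUnit ρ) (hinv : T.IsInvariant ρ) {x : h →L[ℂ] h} (hx : ∀ t, T.map t x = x) :
    ∃ μ : ℂ, x = μ • 1 := by
  obtain ⟨μ, v, hv, hxv⟩ := exists_apply_eq_smul x
  have hfix : ∀ t, T.map t (x - μ • 1) = x - μ • 1 := fun t => by
    rw [map_sub, map_smul, T.map_one, hx]
  refine ⟨μ, sub_eq_zero.mp ?_⟩
  -- With `z = x - μ`, the positive operator `z*z` is fixed and kills the eigenvector `v`, so it
  -- cannot be invertible.
  rcases hT.eq_zero_or_isUnit_of_fixed (star_mul_self_nonneg (x - μ • 1)) (fun t => by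
    rw [map_star_mul_self hρ hu hinv one_pos (hfix 1), hfix]) with h0 | h1
  · exact CStarRing.star_mul_self_eq_zero_iff _ |>.mp h0
  · refine absurd ((ContinuousLinearMap.isUnit_iff_bijective.mp h1).1 (a₁ := v) (a₂ := 0) ?_) hv
    simp [hxv]

/-- A common eigenvector of an irreducible semigroup that is fixed by one map of the semigroup at
a positive time is fixed at all times. -/
theorem IsIrreducible.map_eq_of_eigenvector [Nontrivial h] (hT : T.IsIrreducible) (hρ : 0 ≤ ρ)
    (hu : IsUnit ρ) (hinv : T.IsInvariant ρ) {t₀ : ℝ≥0} (ht₀ : 0 < t₀) {x : h →L[ℂ] h}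
    (hx0 : x ≠ 0) (hx : T.map t₀ x = x) {c : ℝ≥0 → ℂ} (hc : ∀ t, T.map t x = c t • x) (t : ℝ≥0) :
    T.map t x = x := by
  have hxx0 : star x * x ≠ 0 := fun h0 => hx0 (CStarRing.star_mul_self_eq_zero_iff _ |>.mp h0)
  have hmul : ∀ t, T.map t (star x * x) = (star (c t) * c t) • (star x * x) := fun t => by
    rw [map_star_mul_self hρ hu hinv ht₀ hx, hc, star_smul, smul_mul_smul_comm]
  have htr : tr (ρ * (star x * x)) ≠ 0 := fun h0 => hxx0
    (hu.mul_right_eq_zero.mp (mul_eq_zero_of_tr_mul_eq_zero hρ (star_mul_self_nonneg x) h0))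
  -- Invariance of `ρ` preserves the nonzero pairing with `x*x`, so `|c t| = 1` and `x*x` is fixed,
  -- hence scalar.
  have hnorm : ∀ t, star (c t) * c t = 1 := fun t => by
    have := hinv t (star x * x)
    rw [hmul, mul_smul_comm, tr_smul] at this
    exact mul_right_cancel₀ htr (this.trans (one_mul _).symm)
  obtain ⟨d, hd⟩ := hT.exists_eq_smul_one hρ hu hinv (x := star x * x) fun t => by
    rw [hmul, hnorm, one_smul]
  obtain ⟨μ, v, hv, hxv⟩ := exists_apply_eq_smul x
  have hμ : μ ≠ 0 := by
    rintro rfl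
    have h1 : (star x * x) v = 0 := by simp [hxv]
    rw [hd] at h1
    have hd0 : d = 0 := by simpa [hv] using h1
    exact hxx0 (by rw [hd, hd0, zero_smul])
  have hcont : Continuous c := by
    have h1 := (T.continuous_tr_mul_map (star x) x).div_const (tr (star x * x))
    refine h1.congr fun t => ?_
    rw [hc, mul_smul_comm, tr_smul]
    exact mul_div_cancel_right₀ _ fun h0 => hx0 (tr_star_mul_self_eq_zero h0)
  have hint : IsIntegral ℂ x := Algebra.IsIntegral.isIntegral x
  have hroot : ∀ t, c t * μ ∈ (minpoly ℂ x).rootSet ℂ := fun t => by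
    rw [Polynomial.mem_rootSet_of_ne (minpoly.ne_zero hint)]
    have h1 := map_aeval_of_fixed hρ hu hinv ht₀ hx t (minpoly ℂ x)
    rw [minpoly.aeval, _root_.map_zero, hc] at h1
    have h2 : (c t • x) v = (c t * μ) • v := by simp [hxv, smul_smul]
    have h3 : ∀ n : ℕ, ((c t • x) ^ n) v = (c t * μ) ^ n • v := fun n => by
      induction n with
      | zero => simp
      | succ n ih => rw [pow_succ, mul_apply_eq_comp, h2, map_smul, ih, smul_smul,
          pow_succ, mul_comm]
    have h4 : Polynomial.aeval (c t • x) (minpoly ℂ x) v =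
        (Polynomial.aeval (c t * μ) (minpoly ℂ x) : ℂ) • v := by
      rw [Polynomial.aeval_eq_sum_range, Polynomial.aeval_eq_sum_range,
        sum_apply, Finset.sum_smul]
      exact Finset.sum_congr rfl fun n _ => by
        rw [smul_apply, h3, smul_assoc]
    rw [← h1] at h4
    exact (smul_eq_zero.mp h4.symm).resolve_right hv
  -- A continuous map from the connected half-line into a finite set of roots is constant.
  have hconst : c t * μ = c 0 * μ := by
    have hpre : IsPreconnected (Set.range fun s => c s * μ) :=
      isPreconnected_range (hcont.mul continuous_const)
    have hfin : (Set.range fun s => c s * μ).Finite :=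
      ((minpoly ℂ x).rootSet_finite ℂ).subset (Set.range_subset_iff.mpr hroot)
    exact (hfin.countable.isTotallyDisconnected _ subset_rfl hpre) ⟨t, rfl⟩ ⟨0, rfl⟩
  rw [hc, mul_right_cancel₀ hμ hconst, ← hc, T.map_zero]

/-- Faithfulness upgrades `p ≤ T.map t₀ p` to equality. The mean-zero fixed points of `T.map t₀`
form a semigroup-invariant space `W`; a common eigenvector in `W` would be a scalar of mean zero. So
`W = 0` and `p` is scalar. -/
theorem IsIrreducible.isIrreducibleMap [Nontrivial h] (hT : T.IsIrreducible) (hρ : IsDensity ρ)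
    (hu : IsUnit ρ) (hinv : T.IsInvariant ρ) {t₀ : ℝ≥0} (ht₀ : 0 < t₀) :
    IsIrreducibleMap (T.map t₀) := by
  intro p hp hle
  have hpfix : T.map t₀ p = p :=
    (eq_of_le_of_tr_mul_le hρ.1 hu hle (hinv t₀ p).le).symm
  let f : ℝ≥0 → Module.End ℂ (h →L[ℂ] h) := fun t => (T.map t).toLinearMap
  have hf : ∀ t x, f t x = T.map t x := fun t x => rfl
  let W : Submodule ℂ (h →L[ℂ] h) :=
    { carrier := {x | T.map t₀ x = x ∧ tr (ρ * x) = 0}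
      add_mem' := fun {x y} hx hy => ⟨by rw [_root_.map_add, hx.1, hy.1], by
        rw [mul_add, tr_add, hx.2, hy.2, add_zero]⟩
      zero_mem' := ⟨_root_.map_zero _, by rw [mul_zero, tr_zero]⟩
      smul_mem' := fun c x hx => ⟨by rw [map_smul, hx.1], by
        rw [mul_smul_comm, tr_smul, hx.2, mul_zero]⟩ }
  have hcomm : ∀ s t x, T.map s (T.map t x) = T.map t (T.map s x) := fun s t x => by
    rw [← T.map_add, ← T.map_add, add_comm]
  have hW : W = ⊥ := by
    by_contra hne
    obtain ⟨x, ⟨hx, hx1⟩, hx0, hc⟩ := Module.End.exists_common_eigenvector f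
      (fun s t => LinearMap.ext fun x => hcomm s t x) W hne
      (fun t x hx => ⟨by rw [hf, hcomm, hx.1], by rw [hf, hinv, hx.2]⟩)
    choose c hc using hc
    obtain ⟨μ, rfl⟩ := hT.exists_eq_smul_one hρ.1 hu hinv
      (hT.map_eq_of_eigenvector hρ.1 hu hinv ht₀ hx0 hx hc)
    rw [mul_smul_comm, mul_one, tr_smul, hρ.2, mul_one] at hx1
    exact hx0 (by rw [hx1, zero_smul])
  have hmem : p - tr (ρ * p) • 1 ∈ W := by
    refine ⟨by rw [map_sub, map_smul, T.map_one, hpfix], ?_⟩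
    rw [mul_sub, mul_smul_comm, mul_one, tr_sub, tr_smul, hρ.2, mul_one, sub_self]
  rw [hW, Submodule.mem_bot, sub_eq_zero] at hmem
  generalize tr (ρ * p) = c at hmem
  have hcc : c * c = c := by
    have h1 := hp.isIdempotentElem.eq
    rw [hmem, smul_mul_smul_comm, mul_one] at h1
    exact smul_left_injective ℂ (one_ne_zero (α := h →L[ℂ] h)) h1
  rcases IsIdempotentElem.iff_eq_zero_or_one.mp hcc with h0 | h1
  · exact Or.inl (by rw [hmem, h0, zero_smul])
  · exact Or.inr (by rw [hmem, h1, one_smul])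

end FaithfulInvariant

/-! ### Irreducibility and primitivity -/

theorem exists_invariant_density [Nontrivial h] (T : QMS h) :
    ∃ ρ, IsDensity ρ ∧ T.IsInvariant ρ := by
  obtain ⟨ρ, h1, h2, -⟩ := T.exists_invariant_density_of_subharmonic (p := 1)
    (IsStarProjection.one _) one_ne_zero fun t => (T.map_one t).ge
  exact ⟨ρ, h1, h2⟩

theorem IsIrreducible.isUnit_of_isDensity (hT : T.IsIrreducible) {ρ : h →L[ℂ] h}
    (hρ : IsDensity ρ) (hinv : T.IsInvariant ρ) : IsUnit ρ :=
  (hT.eq_zero_or_isUnit_of_isInvariant hρ.1 hinv).resolve_left hρ.ne_zero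

theorem IsIrreducible.isPrimitive [Nontrivial h] (hT : T.IsIrreducible) : T.IsPrimitive := by
  obtain ⟨ρ, hρ, hinv⟩ := T.exists_invariant_density
  exact ⟨ρ, hρ, hinv, isFaithful_iff_isUnit.mpr (hT.isUnit_of_isDensity hρ hinv),
    fun σ hσ hσi => hT.invariant_density_unique hρ hσ hinv hσi⟩

/-- The invariant density supported under `p` must be the faithful one, which leaves no room for `1
- p`. -/
theorem IsPrimitive.isIrreducible [Nontrivial h] (hT : T.IsPrimitive) : T.IsIrreducible := by
  intro p hp hsub
  obtain ⟨ρ, -, -, hfaith, huniq⟩ := hT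
  refine or_iff_not_imp_left.mpr fun hp0 => ?_
  obtain ⟨σ, hσ, hσi, hσp⟩ := T.exists_invariant_density_of_subharmonic hp hp0 hsub
  obtain rfl := huniq σ hσ hσi
  have := mul_eq_zero_of_tr_mul_eq_zero hσ.1 hp.one_sub.nonneg hσp
  exact (sub_eq_zero.mp ((isFaithful_iff_isUnit.mp hfaith).mul_right_eq_zero.mp this)).symm

end QuantumMarkov.QMS

theorem corollary3p5 {h : Type*} [NormedAddCommGroup h] [InnerProductSpace ℂ h]
    [CompleteSpace h] [FiniteDimensional ℂ h] [Nontrivial h] (T : QuantumMarkov.QMS h) :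
    (∃ ρ : h →L[ℂ] h, QuantumMarkov.IsDensity ρ ∧ T.IsInvariant ρ) ∧
    List.TFAE [
      T.IsIrreducible,
      T.IsPrimitive,
      ∀ t₀ : ℝ≥0, 0 < t₀ → QuantumMarkov.IsIrreducibleMap (T.map t₀),
      ∃ t₀ : ℝ≥0, 0 < t₀ ∧ QuantumMarkov.IsIrreducibleMap (T.map t₀)] := by
  refine ⟨T.exists_invariant_density, ?_⟩
  tfae_have 1 → 2 := fun hT => hT.isPrimitive
  tfae_have 2 → 1 := fun hT => hT.isIrreducible
  tfae_have 1 → 3 := fun hT t₀ ht₀ => by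
    obtain ⟨ρ, hρ, hinv⟩ := T.exists_invariant_density
    exact hT.isIrreducibleMap hρ (hT.isUnit_of_isDensity hρ hinv) hinv ht₀
  tfae_have 3 → 4 := fun h3 => ⟨1, one_pos, h3 1 one_pos⟩
  tfae_have 4 → 1 := fun ⟨t₀, _, h4⟩ p hp hsub => h4 p hp (hsub t₀)
  tfae_finish
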